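/- Let $n\ge 2$, $N=\{1,\dots,n\}$, let $\mathcal G^n=\mathbb R^{2^n}$ be the space of functions $v:2^N\to\mathbb R$, and let $\mathcal G(N)=\{v\in\mathcal G^n : v(\emptyset)=0,\ v(N)>0\}$. Write $x(S)=\sum_{k\in S}x_k$, $e^v(S,x)=v(S)-x(S)$, $\mathcal I^0(v)=\{x\in\mathbb R^n: x(N)=v(N)\}$ and, for $i\ne j$, $s_{ij}(x,v)=\max\{e^v(S,x): i\in S,\ j\notin S\}$. The pre-kernel of $v$ is $$\mathcal{P}r\mathcal K(v)=\{x\in\mathcal I^0(v): s_{ij}(x,v)=s_{ji}(x,v)\ \text{for all } i\neq j\}.$$ *The function $h^v$.* Let $\pi(x)=\max_{S\subseteq N}(v(S)-x(S))$, and let $x^{i,j,\delta}$ arise from $x$ by replacing $x_i$ with $x_i-\delta$ and $x_j$ with $x_j+\delta$. Let $\delta_1(x,v)=\max\{|v(S\cup\{k\})-v(S)-x_k| : k\in N,\ S\subseteq N\setminus\{k\}\}$, and for all $v$ and $x$ fix any number $\delta=\delta(v,x)\ge\delta_1(x,v)$. Put $$h^v(x)=\sum_{i<j}\bigl(\pi(x^{i,j,\delta})-\pi(x^{j,i,\delta})\bigr)^2+(x(N)-v(N))^2,\qquad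 M(h^v)=\{x\in\mathcal I^0(v): h^v(x)=0\}.$$ *Classes and quadratic functions.* For $x\in\mathbb R^n$ and $i\ne j$, among the coalitions $S$ with $i\in S$, $j\notin S$, $e^v(S,x)=s_{ij}(x,v)$ let $\mathcal S^v_{ij}(x)$ be the lexicographically first (as increasing lists of players) of those of smallest size. For a family $\sigma=(S_{ij})_{i\ne j}$ of coalitions let $[\sigma]_v=\{x\in\mathbb R^n: \mathcal S^v_{ij}(x)=S_{ij}\text{ for all } i\ne j\}$; the non-empty sets among these are the payoff equivalence classes $[\gamma]$ of $v$. With $q=\binom n2+1$, let $\alpha\in\mathbb R^q$ have the entries $\alpha_{ij}=v(S_{ij})-v(S_{ji})$ ($i<j$) and $\alpha_0=v(N)$, let $E\in\mathbb R^{n\times q}$ have the columns $\mathbf 1_{S_{ji}}-\mathbf 1_{S_{ij}}$ ($i<j$) and $-\mathbf 1_N$, and put $$h^v_\sigma(x)=\tfrac12\langle x,Qx\rangle+\langle x,a\rangle+\|\alpha\|^2,\qquad Q=2EE^\top,\quad a=2E\alpha .$$ Let $\mathcal J'(v)$ be the set of all $\sigma$ with $[\sigma]_v\neq\emptyset$ and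 $\inf\{h^v_\sigma(x):x\in\overline{[\sigma]_v}\}=0$, and let $$Gr_\sigma=\{(v,x)\in\mathcal G^n\times\mathbb R^n: \sigma\in\mathcal J'(v),\ x\in\overline{[\sigma]_v},\ h^v_\sigma(x)=0\}.$$ **Proposition.** One has $$\{(v,x): x\in \mathcal{P}r\mathcal K(v)\}=\{(v,x): x\in M(h^v)\}=\bigcup_{\sigma}Gr_\sigma ,$$ where $(v,x)$ ranges over $\mathcal G^n\times\mathbb R^n$ and the union is over the finitely many families $\sigma$. Moreover $\mathcal{P}r\mathcal K$ is a correspondence $\mathcal G(N)\twoheadrightarrow\mathbb R^n$, that is, $\mathcal{P}r\mathcal K(v)\neq\emptyset$ for all $v\in\mathcal G(N)$; it is closed, that is, its graph is a closed subset of $\mathcal G(N)\times\mathbb R^n$; and it is bounded, that is, $\bigcup_{v\in B}\mathcal{P}r\mathcal K(v)$ is bounded for every bounded $B\subseteq\mathcal G(N)$. -/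

import Mathlib

/-! Transferable utility games with player set `Fin n`, their pre-kernel, the objective function
built from the indirect function, payoff equivalence classes and their quadratic functions. -/

/-- The space of set functions on coalitions, a copy of `ℝ ^ (2 ^ n)`. -/
abbrev Game (n : ℕ) : Type := Finset (Fin n) → ℝ

/-- Payoff vectors. -/
abbrev Payoff (n : ℕ) : Type := Fin n → ℝ

/-- The relevant game space `𝒢(N)`: the empty coalition has worth zero, the grand coalition has
positive worth. -/
def gameSpace (n : ℕ) : Set (Game n) := {v | v ∅ = 0 ∧ 0 < v Finset.univ}

/-- `x(S)`. -/
def coalitionSum {n : ℕ} (x : Payoff n) (S : Finset (Fin n)) : ℝ := ∑ k ∈ S, x k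

/-- The pre-imputation set. -/
def preImputations {n : ℕ} (v : Game n) : Set (Payoff n) :=
  {x | coalitionSum x Finset.univ = v Finset.univ}

/-- The excess `e^v(S, x)`. -/
def excess {n : ℕ} (v : Game n) (x : Payoff n) (S : Finset (Fin n)) : ℝ :=
  v S - coalitionSum x S

/-- The maximum surplus `s_ij(x, v)` for `i ≠ j`: the supremum is over the finite non-empty family
of coalitions that contain `i` but not `j`, hence it is a maximum. -/
noncomputable def maxSurplus {n : ℕ} (v : Game n) (x : Payoff n) (i j : Fin n) : ℝ :=
  ⨆ S : {S : Finset (Fin n) // i ∈ S ∧ j ∉ S}, excess v x S.1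

/-- The pre-kernel. -/
def preKernel {n : ℕ} (v : Game n) : Set (Payoff n) :=
  {x | x ∈ preImputations v ∧ ∀ i j : Fin n, i ≠ j → maxSurplus v x i j = maxSurplus v x j i}

/-- The graph of a set-valued map. -/
def graph {X Y : Type*} (σ : X → Set Y) : Set (X × Y) := {p | p.2 ∈ σ p.1}

/-- The indirect function `π`; the supremum is over all coalitions, hence a maximum. -/
noncomputable def indirectFn {n : ℕ} (v : Game n) (x : Payoff n) : ℝ :=
  ⨆ S : Finset (Fin n), (v S - coalitionSum x S)

/-- The critical number `δ₁(x, v)`: the maximum of `|v(S ∪ {k}) - v(S) - x_k|` over players `k`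
and coalitions `S` not containing `k`. -/
noncomputable def deltaOne {n : ℕ} (v : Game n) (x : Payoff n) : ℝ :=
  ⨆ p : {p : Fin n × Finset (Fin n) // p.1 ∉ p.2},
    |v (insert p.1.1 p.1.2) - v p.1.2 - x p.1.1|

/-- `x^{i,j,δ}`: player `i` gives the amount `δ` to player `j` (used for `i ≠ j`). -/
def transfer {n : ℕ} (x : Payoff n) (i j : Fin n) (δ : ℝ) : Payoff n :=
  fun k => if k = i then x k - δ else if k = j then x k + δ else x k

/-- The pairs `i < j`. -/
abbrev UpperPair (n : ℕ) : Type := {p : Fin n × Fin n // p.1 < p.2}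

/-- `f_ij`, computed with the transfer `δ`. -/
noncomputable def pairDefect {n : ℕ} (v : Game n) (δ : ℝ) (x : Payoff n) (i j : Fin n) : ℝ :=
  indirectFn v (transfer x i j δ) - indirectFn v (transfer x j i δ)

/-- The objective function `h^v`, computed at `x` with the transfer `δ`. -/
noncomputable def objective {n : ℕ} (v : Game n) (δ : ℝ) (x : Payoff n) : ℝ :=
  (∑ p : UpperPair n, pairDefect v δ x p.1.1 p.1.2 ^ 2) +
    (coalitionSum x Finset.univ - v Finset.univ) ^ 2

/-- `M(h^v)`; the transfer `δ x` may depend on the payoff vector `x`. -/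
def zeroSet {n : ℕ} (v : Game n) (δ : Payoff n → ℝ) : Set (Payoff n) :=
  {x | x ∈ preImputations v ∧ objective v (δ x) x = 0}

/-- Coalitions are compared by size first, and lexicographically (as increasing lists of players)
when they have the same size: then the smallest player that belongs to exactly one of the two
coalitions belongs to the smaller one. -/
def Precedes {n : ℕ} (S T : Finset (Fin n)) : Prop :=
  S.card < T.card ∨
    (S.card = T.card ∧ ∃ a, a ∈ S ∧ a ∉ T ∧ ∀ b, b < a → (b ∈ S ↔ b ∈ T))

/-- The set `𝒞_ij(x)` of most effective coalitions. -/
def mostEffective {n : ℕ} (v : Game n) (x : Payoff n) (i j : Fin n) : Set (Finset (Fin n)) :=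
  {S | i ∈ S ∧ j ∉ S ∧ excess v x S = maxSurplus v x i j}

theorem precedes_asymm {n : ℕ} {S T : Finset (Fin n)} (h : Precedes S T) : ¬ Precedes T S := by
  rintro (h' | ⟨hc', b, hbT, hbS, hb⟩)
  · rcases h with h | ⟨hc, -⟩ <;> omega
  · rcases h with h | ⟨hc, a, haS, haT, ha⟩
    · omega
    · rcases lt_trichotomy a b with hab | hab | hab
      · exact haT ((hb a hab).2 haS)
      · exact haT (hab ▸ hbT)
      · exact hbS ((ha b hab).2 hbT)

theorem precedes_total {n : ℕ} {S T : Finset (Fin n)} (h : S ≠ T) :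
    Precedes S T ∨ Precedes T S := by
  rcases lt_trichotomy S.card T.card with hc | hc | hc
  · exact Or.inl (Or.inl hc)
  · have hne : (symmDiff S T).Nonempty := by
      rw [Finset.nonempty_iff_ne_empty]
      intro h0
      exact h (symmDiff_eq_bot.1 h0)
    have hmin : ∀ b, b < (symmDiff S T).min' hne → (b ∈ S ↔ b ∈ T) := by
      intro b hb
      by_contra hcon
      have hmem : b ∈ symmDiff S T := by
        rw [Finset.mem_symmDiff]
        tauto
      exact absurd ((symmDiff S T).min'_le b hmem) (not_le.2 hb)
    have hm := (symmDiff S T).min'_mem hne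
    rcases Finset.mem_symmDiff.1 hm with ⟨h1, h2⟩ | ⟨h1, h2⟩
    · exact Or.inl (Or.inr ⟨hc, _, h1, h2, hmin⟩)
    · exact Or.inr (Or.inr ⟨hc.symm, _, h1, h2, fun b hb => (hmin b hb).symm⟩)
  · exact Or.inr (Or.inl hc)

theorem precedes_trans {n : ℕ} {S T U : Finset (Fin n)} (h₁ : Precedes S T)
    (h₂ : Precedes T U) : Precedes S U := by
  rcases h₁ with h₁ | ⟨c₁, a, haS, haT, ha⟩
  · rcases h₂ with h₂ | ⟨c₂, -⟩ <;> left <;> omega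
  · rcases h₂ with h₂ | ⟨c₂, b, hbT, hbU, hb⟩
    · left
      omega
    · refine Or.inr ⟨c₁.trans c₂, ?_⟩
      rcases lt_trichotomy a b with hab | hab | hab
      · exact ⟨a, haS, fun hU => haT ((hb a hab).2 hU),
          fun c hc => (ha c hc).trans (hb c (hc.trans hab))⟩
      · exact absurd (hab ▸ hbT) haT
      · exact ⟨b, (ha b hab).2 hbT, hbU, fun c hc => (ha c (hc.trans hab)).trans (hb c hc)⟩

/-- A non-empty set of coalitions has exactly one smallest element. -/
theorem existsUnique_first {n : ℕ} (F : Set (Finset (Fin n))) (hF : F.Nonempty) :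
    ∃! S, S ∈ F ∧ ∀ T ∈ F, T ≠ S → Precedes S T := by
  have hwf : WellFounded (Precedes (n := n)) := by
    have : IsTrans (Finset (Fin n)) Precedes := ⟨fun _ _ _ => precedes_trans⟩
    have : Std.Irrefl (Precedes (n := n)) := ⟨fun S h => precedes_asymm h h⟩
    exact Finite.wellFounded_of_trans_of_irrefl _
  obtain ⟨S, hS, hmin⟩ := hwf.has_min F hF
  refine ⟨S, ⟨hS, fun T hT hne => ?_⟩, ?_⟩
  · exact (precedes_total hne).resolve_left (hmin T hT)
  · rintro T ⟨hT, hT'⟩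
    by_contra hne
    exact hmin T hT (hT' S hS (Ne.symm hne))

theorem mostEffective_nonempty {n : ℕ} (v : Game n) (x : Payoff n) {i j : Fin n} (h : i ≠ j) :
    (mostEffective v x i j).Nonempty := by
  have : Nonempty {S : Finset (Fin n) // i ∈ S ∧ j ∉ S} :=
    ⟨⟨{i}, by simp, by simpa using h.symm⟩⟩
  obtain ⟨S, hS⟩ := exists_eq_ciSup_of_finite
    (f := fun S : {S : Finset (Fin n) // i ∈ S ∧ j ∉ S} => excess v x S.1)
  exact ⟨S.1, S.2.1, S.2.2, hS⟩

/-- Ordered pairs of distinct players. -/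
abbrev OrderedPair (n : ℕ) : Type := {p : Fin n × Fin n // p.1 ≠ p.2}

/-- A choice of one coalition `S_ij` for each ordered pair of distinct players; there are only
finitely many. -/
abbrev Profile (n : ℕ) : Type := OrderedPair n → Finset (Fin n)

/-- The family `𝒮(x)` of lexicographically smallest most effective coalitions `𝒮_ij(x)`. -/
noncomputable def profile {n : ℕ} (v : Game n) (x : Payoff n) : Profile n := fun p =>
  (existsUnique_first (mostEffective v x p.1.1 p.1.2) (mostEffective_nonempty v x p.2)).choose

/-- The payoff equivalence class of the game `v` on which the family of lexicographically smallest
most effective coalitions is `s`. Thus `payoffClass v (profile v γ)` is `[γ]`. -/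
def payoffClass {n : ℕ} (v : Game n) (s : Profile n) : Set (Payoff n) :=
  {x | profile v x = s}

/-- The `q = n (n - 1) / 2 + 1` coordinates: the pairs `i < j`, and `none` for the coordinate
`0`. -/
abbrev Coord (n : ℕ) : Type := Option (UpperPair n)

/-- `S_ij` for `i < j`. -/
def Profile.fst {n : ℕ} (s : Profile n) (p : UpperPair n) : Finset (Fin n) :=
  s ⟨(p.1.1, p.1.2), ne_of_lt p.2⟩

/-- `S_ji` for `i < j`. -/
def Profile.snd {n : ℕ} (s : Profile n) (p : UpperPair n) : Finset (Fin n) :=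
  s ⟨(p.1.2, p.1.1), ne_of_gt p.2⟩

/-- The vector `α`, with `α_ij = v(S_ij) - v(S_ji)` and `α_0 = v(N)`. -/
def alphaVec {n : ℕ} (v : Game n) (s : Profile n) : Coord n → ℝ
  | none => v Finset.univ
  | some p => v (s.fst p) - v (s.snd p)

/-- The matrix `E`, with columns `E_ij = 1_{S_ji} - 1_{S_ij}` and `E_0 = -1_N`. -/
def matE {n : ℕ} (s : Profile n) : Matrix (Fin n) (Coord n) ℝ := Matrix.of fun k c =>
  match c with
  | none => -1
  | some p => (if k ∈ s.snd p then 1 else 0) - (if k ∈ s.fst p then 1 else 0)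

/-- The matrix `Q = 2 E Eᵀ`. -/
def matQ {n : ℕ} (s : Profile n) : Matrix (Fin n) (Fin n) ℝ :=
  (2 : ℝ) • (matE s * (matE s).transpose)

/-- The vector `a = 2 E α`. -/
def vecA {n : ℕ} (v : Game n) (s : Profile n) : Payoff n :=
  (2 : ℝ) • (matE s).mulVec (alphaVec v s)

/-- The quadratic function `h^v_γ(x) = (1/2) ⟨x, Q x⟩ + ⟨x, a⟩ + ‖α‖²`, where `s` is the family of
coalitions induced by `γ`. -/
noncomputable def quadFn {n : ℕ} (v : Game n) (s : Profile n) (x : Payoff n) : ℝ :=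
  (1 / 2) * (x ⬝ᵥ (matQ s).mulVec x) + x ⬝ᵥ vecA v s + alphaVec v s ⬝ᵥ alphaVec v s

/-- The restricted solution set `M(h^v_γ, closure [γ])`. -/
def restrictedZeroSet {n : ℕ} (v : Game n) (s : Profile n) : Set (Payoff n) :=
  {x | x ∈ closure (payoffClass v s) ∧ quadFn v s x = 0}

/-- The index set `𝒥'` of the game `v`: the non-empty classes `[γ]` of `v` for which the minimal
value of `h^v_γ` on the closure of `[γ]` is zero. -/
def activeProfiles {n : ℕ} (v : Game n) : Set (Profile n) :=
  {s | s ∈ Set.range (profile v) ∧ sInf (quadFn v s '' closure (payoffClass v s)) = 0}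

/-- The graph of the restricted solution sets for the class with index `s`, over the games in
whose index set `s` occurs. -/
def restrictedGraph {n : ℕ} (s : Profile n) : Set (Game n × Payoff n) :=
  {p | s ∈ activeProfiles p.1 ∧ p.2 ∈ restrictedZeroSet p.1 s}

/-! All three descriptions are the vanishing of one sum of squares, with terms `s_ij - s_ji` for `i
< j` and `x(N) - v(N)`. For `h^v` this holds because a transfer of at least `δ₁` turns `π` into
`s_ij + δ` (`indirectFn_transfer`). For `h^v_σ` it holds on the closure of the class, where `S_ij`
still attains `s_ij` (`excess_eq_maxSurplus_of_mem_closure`, `quadFn_eq_sum`).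

The graph is closed because maximum surpluses are jointly continuous in game and payoff. Boundedness
comes from balancing a coalition of maximal excess against one that lacks its worst-paid member
(`indirectFn_le_of_mem_preKernel`).

For existence, minimize the sum of `exp (t * excess)` over the pre-imputations. The first-order
condition balances the exponential sums of the two sides of each pair, so `s_ij` and `s_ji` differ
by at most `n / t` (`maxSurplus_le_add_div`). The minimizers for all `t ≥ 1` lie in one compact set,
and a limit point as `t → ∞` is in the pre-kernel. -/

/-! ### The indirect function and maximum surpluses -/

lemma excess_le_maxSurplus {n : ℕ} (v : Game n) (x : Payoff n) {i j : Fin n}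
    {S : Finset (Fin n)} (hi : i ∈ S) (hj : j ∉ S) : excess v x S ≤ maxSurplus v x i j :=
  le_ciSup (f := fun S : {S : Finset (Fin n) // i ∈ S ∧ j ∉ S} => excess v x S.1)
    (Set.finite_range _).bddAbove ⟨S, hi, hj⟩

lemma exists_excess_eq_maxSurplus {n : ℕ} (v : Game n) (x : Payoff n) {i j : Fin n}
    (h : i ≠ j) : ∃ S, i ∈ S ∧ j ∉ S ∧ excess v x S = maxSurplus v x i j :=
  mostEffective_nonempty v x h

lemma excess_le_indirectFn {n : ℕ} (v : Game n) (x : Payoff n) (S : Finset (Fin n)) :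
    excess v x S ≤ indirectFn v x :=
  le_ciSup (f := fun S : Finset (Fin n) => v S - coalitionSum x S)
    (Set.finite_range _).bddAbove S

lemma exists_excess_eq_indirectFn {n : ℕ} (v : Game n) (x : Payoff n) :
    ∃ S, excess v x S = indirectFn v x :=
  exists_eq_ciSup_of_finite (f := fun S : Finset (Fin n) => v S - coalitionSum x S)

lemma coalitionSum_insert {n : ℕ} (x : Payoff n) {k : Fin n} {S : Finset (Fin n)}
    (hk : k ∉ S) : coalitionSum x (insert k S) = x k + coalitionSum x S :=
  Finset.sum_insert hk

lemma coalitionSum_singleton {n : ℕ} (x : Payoff n) (k : Fin n) :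
    coalitionSum x {k} = x k :=
  Finset.sum_singleton _ _

lemma coalitionSum_transfer {n : ℕ} (x : Payoff n) {i j : Fin n} (h : i ≠ j) (d : ℝ)
    (S : Finset (Fin n)) :
    coalitionSum (transfer x i j d) S =
      coalitionSum x S - (if i ∈ S then d else 0) + (if j ∈ S then d else 0) := by
  have hk : ∀ k, transfer x i j d k =
      x k - (if k = i then d else 0) + (if k = j then d else 0) := by
    intro k
    unfold transfer
    by_cases h1 : k = i
    · have h2 : k ≠ j := fun h2 => h (h1.symm.trans h2)
      simp [h1, h]
    · simp only [h1, if_false]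
      split_ifs <;> ring
  simp only [coalitionSum, hk, Finset.sum_add_distrib, Finset.sum_sub_distrib,
    Finset.sum_ite_eq']

lemma abs_excess_insert_sub_le_deltaOne {n : ℕ} (v : Game n) (x : Payoff n) {k : Fin n}
    {S : Finset (Fin n)} (hk : k ∉ S) :
    |excess v x (insert k S) - excess v x S| ≤ deltaOne v x := by
  have h := le_ciSup (f := fun p : {p : Fin n × Finset (Fin n) // p.1 ∉ p.2} =>
    |v (insert p.1.1 p.1.2) - v p.1.2 - x p.1.1|) (Set.finite_range _).bddAbove ⟨(k, S), hk⟩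
  have he : excess v x (insert k S) - excess v x S = v (insert k S) - v S - x k := by
    simp only [excess, coalitionSum_insert x hk]
    ring
  rw [he]
  exact h

/-- The transfer raises by `d` the excess of coalitions with `i` and without `j`, lowers by `d`
those with `j` and without `i`, and fixes the rest. Inserting or erasing one player costs at most
`d` in the original excess, so moving to a coalition with `i` and without `j` never loses. -/
lemma indirectFn_transfer {n : ℕ} (v : Game n) (x : Payoff n) {i j : Fin n} (h : i ≠ j)
    {d : ℝ} (hd : deltaOne v x ≤ d) :
    indirectFn v (transfer x i j d) = maxSurplus v x i j + d := by
  have hex : ∀ S, excess v (transfer x i j d) S =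
      excess v x S + (if i ∈ S then d else 0) - (if j ∈ S then d else 0) := by
    intro S
    simp only [excess, coalitionSum_transfer x h]
    ring
  have hadd : ∀ {k : Fin n} {S : Finset (Fin n)}, k ∉ S →
      excess v x S ≤ excess v x (insert k S) + d ∧
      excess v x (insert k S) ≤ excess v x S + d := by
    intro k S hk
    have := abs_le.1 ((abs_excess_insert_sub_le_deltaOne v x hk).trans hd)
    constructor <;> linarith [this.1, this.2]
  have hrem : ∀ {S : Finset (Fin n)}, j ∈ S → excess v x S ≤ excess v x (S.erase j) + d := by
    intro S hj
    have := (hadd (Finset.notMem_erase j S)).2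
    rwa [Finset.insert_erase hj] at this
  apply le_antisymm
  · obtain ⟨S, hS⟩ := exists_excess_eq_indirectFn v (transfer x i j d)
    rw [← hS, hex]
    by_cases hi : i ∈ S <;> by_cases hj : j ∈ S
    · simp only [hi, hj, if_true]
      have h1 := excess_le_maxSurplus v x (i := i) (j := j) (S := S.erase j)
        (by simp [h, hi]) (by simp)
      linarith [hrem hj]
    · simp only [hi, hj, if_true, if_false]
      linarith [excess_le_maxSurplus v x hi hj]
    -- Two moves, erasing `j` and inserting `i`: they cost at most `2 * d`, exactly the gap between
    -- `-d` and `+d`.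
    · simp only [hi, hj, if_true, if_false]
      have h0 : i ∉ S.erase j := by simp [hi]
      have h1 := excess_le_maxSurplus v x (i := i) (j := j) (S := insert i (S.erase j))
        (by simp) (by simp [h.symm])
      linarith [hrem hj, (hadd h0).1]
    · simp only [hi, hj, if_false]
      have h1 := excess_le_maxSurplus v x (i := i) (j := j) (S := insert i S)
        (by simp) (by simp [h.symm, hj])
      linarith [(hadd hi).1]
  · obtain ⟨S, hi, hj, hS⟩ := exists_excess_eq_maxSurplus v x h
    have := excess_le_indirectFn v (transfer x i j d) S
    rw [hex, if_pos hi, if_neg hj, hS] at this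
    linarith

lemma objective_eq {n : ℕ} (v : Game n) (x : Payoff n) {d : ℝ} (hd : deltaOne v x ≤ d) :
    objective v d x =
      (∑ p : UpperPair n, (maxSurplus v x p.1.1 p.1.2 - maxSurplus v x p.1.2 p.1.1) ^ 2) +
        (coalitionSum x Finset.univ - v Finset.univ) ^ 2 := by
  unfold objective pairDefect
  congr 1
  refine Finset.sum_congr rfl fun p _ => ?_
  rw [indirectFn_transfer v x p.2.ne hd, indirectFn_transfer v x p.2.ne' hd]
  ring

lemma mem_preKernel_iff_sum_eq_zero {n : ℕ} (v : Game n) (x : Payoff n) :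
    x ∈ preKernel v ↔
      (∑ p : UpperPair n, (maxSurplus v x p.1.1 p.1.2 - maxSurplus v x p.1.2 p.1.1) ^ 2) +
        (coalitionSum x Finset.univ - v Finset.univ) ^ 2 = 0 := by
  rw [add_eq_zero_iff_of_nonneg (Finset.sum_nonneg fun _ _ => sq_nonneg _) (sq_nonneg _),
    Finset.sum_eq_zero_iff_of_nonneg fun _ _ => sq_nonneg _]
  simp only [sq_eq_zero_iff, sub_eq_zero, Finset.mem_univ, true_imp_iff]
  constructor
  · rintro ⟨h1, h2⟩
    exact ⟨fun p => h2 _ _ p.2.ne, h1⟩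
  · rintro ⟨h1, h2⟩
    refine ⟨h2, fun i j hij => ?_⟩
    rcases lt_or_gt_of_ne hij with h | h
    · exact h1 ⟨(i, j), h⟩
    · exact (h1 ⟨(j, i), h⟩).symm

lemma zeroSet_eq_preKernel {n : ℕ} (v : Game n) {δ : Payoff n → ℝ}
    (hδ : ∀ x, deltaOne v x ≤ δ x) : zeroSet v δ = preKernel v := by
  ext x
  rw [mem_preKernel_iff_sum_eq_zero, ← objective_eq v x (hδ x)]
  refine ⟨fun h => h.2, fun h => ⟨?_, h⟩⟩
  rw [objective_eq v x (hδ x), ← mem_preKernel_iff_sum_eq_zero] at h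
  exact h.1

/-! ### Continuity, payoff classes and their quadratic functions -/

lemma continuous_coalitionSum {n : ℕ} (S : Finset (Fin n)) :
    Continuous fun x : Payoff n => coalitionSum x S :=
  continuous_finsetSum _ fun k _ => continuous_apply k

lemma continuous_excess {n : ℕ} (S : Finset (Fin n)) :
    Continuous fun p : Game n × Payoff n => excess p.1 p.2 S :=
  ((continuous_apply S).comp continuous_fst).sub
    ((continuous_coalitionSum S).comp continuous_snd)

lemma continuous_maxSurplus {n : ℕ} {i j : Fin n} (h : i ≠ j) :
    Continuous fun p : Game n × Payoff n => maxSurplus p.1 p.2 i j := by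
  have : Nonempty {S : Finset (Fin n) // i ∈ S ∧ j ∉ S} :=
    ⟨⟨{i}, by simp, by simpa using h.symm⟩⟩
  simp only [maxSurplus, ← Finset.sup'_univ_eq_ciSup]
  exact Continuous.finset_sup'_apply _ fun S _ => continuous_excess S.1

lemma continuous_maxSurplus_right {n : ℕ} (v : Game n) {i j : Fin n} (h : i ≠ j) :
    Continuous fun x : Payoff n => maxSurplus v x i j :=
  (continuous_maxSurplus h).comp (Continuous.prodMk_right v)

lemma excess_profile {n : ℕ} (v : Game n) (x : Payoff n) (p : OrderedPair n) :
    excess v x (profile v x p) = maxSurplus v x p.1.1 p.1.2 :=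
  (existsUnique_first _ (mostEffective_nonempty v x p.2)).choose_spec.1.1.2.2

/-- The tie-breaking rule need not survive limits, but attaining the maximum is a closed condition.
-/
lemma excess_eq_maxSurplus_of_mem_closure {n : ℕ} {v : Game n} {s : Profile n}
    {x : Payoff n} (hx : x ∈ closure (payoffClass v s)) (p : OrderedPair n) :
    excess v x (s p) = maxSurplus v x p.1.1 p.1.2 := by
  have hc : IsClosed {y : Payoff n | excess v y (s p) = maxSurplus v y p.1.1 p.1.2} :=
    isClosed_eq ((continuous_excess (s p)).comp (Continuous.prodMk_right v))
      (continuous_maxSurplus_right v p.2)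
  refine closure_minimal (fun y hy => ?_) hc hx
  have hy' : profile v y = s := hy
  exact hy' ▸ excess_profile v y p

/-- Expansion of the square `‖Eᵀx + α‖²`. -/
lemma quadFn_eq_dotProduct {n : ℕ} (v : Game n) (s : Profile n) (x : Payoff n) :
    quadFn v s x = ((matE s).transpose.mulVec x + alphaVec v s) ⬝ᵥ
      ((matE s).transpose.mulVec x + alphaVec v s) := by
  have h1 : ∀ w : Coord n → ℝ, x ⬝ᵥ (matE s).mulVec w = (matE s).transpose.mulVec x ⬝ᵥ w := by
    intro w
    rw [Matrix.dotProduct_mulVec, Matrix.mulVec_transpose]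
  unfold quadFn matQ vecA
  rw [Matrix.smul_mulVec, dotProduct_smul, dotProduct_smul, ← Matrix.mulVec_mulVec, h1, h1,
    add_dotProduct, dotProduct_add, dotProduct_add,
    dotProduct_comm (alphaVec v s) ((matE s).transpose.mulVec x)]
  simp only [smul_eq_mul]
  ring

lemma quadFn_eq_sum {n : ℕ} (v : Game n) (s : Profile n) (x : Payoff n) :
    quadFn v s x =
      (∑ p : UpperPair n, (excess v x (s.fst p) - excess v x (s.snd p)) ^ 2) +
        (coalitionSum x Finset.univ - v Finset.univ) ^ 2 := by
  have h0 : (matE s).transpose.mulVec x none = -coalitionSum x Finset.univ := by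
    simp [Matrix.mulVec, dotProduct, matE, coalitionSum]
  have h1 : ∀ p, (matE s).transpose.mulVec x (some p) =
      coalitionSum x (s.snd p) - coalitionSum x (s.fst p) := by
    intro p
    simp [Matrix.mulVec, dotProduct, matE, coalitionSum, sub_mul, Finset.sum_sub_distrib]
  rw [quadFn_eq_dotProduct]
  simp only [dotProduct, Fintype.sum_option, Pi.add_apply, h0, h1, alphaVec, excess]
  rw [add_comm]
  congr 1
  · exact Finset.sum_congr rfl fun p _ => by ring
  · ring

lemma quadFn_nonneg {n : ℕ} (v : Game n) (s : Profile n) (x : Payoff n) :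
    0 ≤ quadFn v s x := by
  rw [quadFn_eq_sum]
  positivity

lemma quadFn_eq_zero_iff_of_mem_closure {n : ℕ} {v : Game n} {s : Profile n}
    {x : Payoff n} (hx : x ∈ closure (payoffClass v s)) :
    quadFn v s x = 0 ↔ x ∈ preKernel v := by
  rw [mem_preKernel_iff_sum_eq_zero, quadFn_eq_sum]
  have h : ∀ p : UpperPair n, excess v x (s.fst p) - excess v x (s.snd p) =
      maxSurplus v x p.1.1 p.1.2 - maxSurplus v x p.1.2 p.1.1 := fun p =>
    congrArg₂ (· - ·) (excess_eq_maxSurplus_of_mem_closure hx ⟨(p.1.1, p.1.2), ne_of_lt p.2⟩)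
      (excess_eq_maxSurplus_of_mem_closure hx ⟨(p.1.2, p.1.1), ne_of_gt p.2⟩)
  simp only [h]

lemma graph_preKernel_eq_iUnion (n : ℕ) :
    graph (fun v : Game n => preKernel v) = ⋃ s : Profile n, restrictedGraph s := by
  ext ⟨v, x⟩
  simp only [graph, restrictedGraph, restrictedZeroSet, activeProfiles, Set.mem_ofPred_eq,
    Set.mem_iUnion]
  constructor
  · intro hx
    have hcl : x ∈ closure (payoffClass v (profile v x)) := subset_closure rfl
    have h0 := (quadFn_eq_zero_iff_of_mem_closure hcl).2 hx
    refine ⟨profile v x, ⟨⟨x, rfl⟩, ?_⟩, hcl, h0⟩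
    -- The infimum is attained at `x` itself, since the quadratic function is a sum of squares.
    refine IsLeast.csInf_eq ⟨⟨x, hcl, h0⟩, ?_⟩
    rintro _ ⟨y, -, rfl⟩
    exact quadFn_nonneg _ _ _
  · rintro ⟨s, -, hcl, h0⟩
    exact (quadFn_eq_zero_iff_of_mem_closure hcl).1 h0

/-! ### Closedness and boundedness -/

lemma isClosed_graph_preKernel (n : ℕ) :
    IsClosed (graph (fun v : Game n => preKernel v)) := by
  have h : graph (fun v : Game n => preKernel v) =
      {p : Game n × Payoff n | coalitionSum p.2 Finset.univ = p.1 Finset.univ} ∩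
        ⋂ (i : Fin n) (j : Fin n) (_ : i ≠ j),
          {p : Game n × Payoff n | maxSurplus p.1 p.2 i j = maxSurplus p.1 p.2 j i} := by
    ext p
    simp only [graph, preKernel, preImputations, Set.mem_ofPred_eq, Set.mem_inter_iff,
      Set.mem_iInter]
  rw [h]
  refine (isClosed_eq ((continuous_coalitionSum _).comp continuous_snd)
    ((continuous_apply _).comp continuous_fst)).inter ?_
  exact isClosed_iInter fun i => isClosed_iInter fun j => isClosed_iInter fun hij =>
    isClosed_eq (continuous_maxSurplus hij) (continuous_maxSurplus hij.symm)

/-- At a pre-kernel point the largest excess is bounded by the worths of the coalitions. -/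
lemma indirectFn_le_of_mem_preKernel {n : ℕ} {v : Game n} {x : Payoff n} {c : ℝ}
    (hc : ∀ S, |v S| ≤ c) (hx : x ∈ preKernel v) : indirectFn v x ≤ (2 * n + 1) * c := by
  have hc0 : 0 ≤ c := (abs_nonneg _).trans (hc ∅)
  have hnc : 0 ≤ 2 * (n : ℝ) * c := by positivity
  obtain ⟨S, hS⟩ := exists_excess_eq_indirectFn v x
  rcases S.eq_empty_or_nonempty with rfl | hne
  · have : excess v x ∅ = v ∅ := by simp [excess, coalitionSum]
    linarith [(abs_le.1 (hc ∅)).2]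
  by_cases hu : S = Finset.univ
  · have h1 : coalitionSum x Finset.univ = v Finset.univ := hx.1
    have : excess v x S = 0 := by rw [hu, excess, h1, sub_self]
    linarith
  obtain ⟨i, hi⟩ : ∃ i, i ∉ S := by
    by_contra! h
    exact hu (Finset.eq_univ_iff_forall.2 h)
  -- A lower bound for the smallest payoff in `S` bounds `x(S)` from below, hence the excess of `S`
  -- from above.
  obtain ⟨j, hj, hmin⟩ := S.exists_min_image x hne
  have hji : j ≠ i := fun h => hi (h ▸ hj)
  obtain ⟨T, hiT, hjT, hT⟩ := exists_excess_eq_maxSurplus v x hji.symm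
  -- By `s_ji = s_ij`, the coalition `T` without `j` also has maximal excess. Adding `j` cannot
  -- increase it, which forces `x j ≥ v(T ∪ {j}) - v(T) ≥ -2c`.
  have hμ : indirectFn v x ≤ excess v x T := by
    rw [hT, ← hx.2 j i hji, ← hS]
    exact excess_le_maxSurplus v x hj hi
  have hins := excess_le_indirectFn v x (insert j T)
  have hxj : -(2 * c) ≤ x j := by
    simp only [excess, coalitionSum_insert x hjT] at hins hμ
    linarith [(abs_le.1 (hc T)).2, (abs_le.1 (hc (insert j T))).1]
  have hsum : (S.card : ℝ) * (-(2 * c)) ≤ coalitionSum x S := by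
    rw [← nsmul_eq_mul]
    exact Finset.card_nsmul_le_sum _ _ _ fun k hk => hxj.trans (hmin k hk)
  have hcard : (S.card : ℝ) ≤ n := by
    exact_mod_cast (Finset.card_le_univ S).trans_eq (Fintype.card_fin n)
  have : (S.card : ℝ) * (2 * c) ≤ n * (2 * c) := by gcongr
  have hv := (abs_le.1 (hc S)).2
  simp only [excess] at hS
  linarith

lemma le_of_coalitionSum_univ_le {n : ℕ} {x : Payoff n} {b c : ℝ} (hb : 0 ≤ b)
    (hx : ∀ k, -b ≤ x k) (hc : coalitionSum x Finset.univ ≤ c) (k : Fin n) :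
    x k ≤ c + n * b := by
  have h1 : coalitionSum x Finset.univ = x k + ∑ l ∈ Finset.univ.erase k, x l :=
    (Finset.add_sum_erase _ _ (Finset.mem_univ k)).symm
  have h2 : ((Finset.univ.erase k).card : ℝ) * (-b) ≤ ∑ l ∈ Finset.univ.erase k, x l := by
    rw [← nsmul_eq_mul]
    exact Finset.card_nsmul_le_sum _ _ _ fun l _ => hx l
  have hcard : ((Finset.univ.erase k).card : ℝ) ≤ n := by
    exact_mod_cast (Finset.card_le_univ _).trans_eq (Fintype.card_fin n)
  have : ((Finset.univ.erase k).card : ℝ) * b ≤ n * b := by gcongr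
  linarith

lemma isBounded_iUnion_preKernel {n : ℕ} {B : Set (Game n)} (hB : Bornology.IsBounded B) :
    Bornology.IsBounded (⋃ v ∈ B, preKernel v) := by
  obtain ⟨c, hc⟩ := hB.exists_norm_le
  -- The bound `2n + 1` on the excess of `{k}` plus one for `v {k}`; `max` covers a negative `c`,
  -- possible when `B` is empty.
  let b : ℝ := (2 * n + 2) * max c 0
  refine (Metric.isBounded_Icc (fun _ => -b : Payoff n)
    (fun _ => max c 0 + n * b)).subset ?_
  intro x hx
  simp only [Set.mem_iUnion, exists_prop] at hx
  obtain ⟨v, hv, hx⟩ := hx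
  have hvc : ∀ S, |v S| ≤ max c 0 := fun S =>
    ((norm_le_pi_norm v S).trans (hc v hv)).trans (le_max_left _ _)
  have hμ := indirectFn_le_of_mem_preKernel hvc hx
  have hlow : ∀ k, -b ≤ x k := by
    intro k
    have h1 := excess_le_indirectFn v x {k}
    simp only [excess, coalitionSum_singleton] at h1
    simp only [b]
    linarith [(abs_le.1 (hvc {k})).1]
  have hb : 0 ≤ b := by positivity
  have hu : coalitionSum x Finset.univ ≤ max c 0 := by
    have h1 : coalitionSum x Finset.univ = v Finset.univ := hx.1
    exact h1 ▸ (abs_le.1 (hvc _)).2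
  exact ⟨hlow, le_of_coalitionSum_univ_le hb hlow hu⟩

/-! ### Existence by exponential penalties -/

/-- The exponential penalty of the excesses. -/
noncomputable def expPenalty {n : ℕ} (v : Game n) (t : ℝ) (x : Payoff n) : ℝ :=
  ∑ S : Finset (Fin n), Real.exp (t * excess v x S)

lemma continuous_expPenalty {n : ℕ} (v : Game n) (t : ℝ) : Continuous (expPenalty v t) :=
  continuous_finsetSum _ fun S _ => Real.continuous_exp.comp
    (continuous_const.mul ((continuous_excess S).comp (Continuous.prodMk_right v)))

lemma exp_le_expPenalty {n : ℕ} (v : Game n) (t : ℝ) (x : Payoff n) (S : Finset (Fin n)) :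
    Real.exp (t * excess v x S) ≤ expPenalty v t x :=
  Finset.single_le_sum (f := fun S => Real.exp (t * excess v x S))
    (fun _ _ => (Real.exp_pos _).le) (Finset.mem_univ S)

/-- There are at most `2 ^ n ≤ exp n` summands. -/
lemma sum_exp_le {n : ℕ} (F : Finset (Finset (Fin n))) {f : Finset (Fin n) → ℝ} {m : ℝ}
    (hf : ∀ S ∈ F, f S ≤ m) : ∑ S ∈ F, Real.exp (f S) ≤ Real.exp (n + m) := by
  have h1 : ∑ S ∈ F, Real.exp (f S) ≤ F.card • Real.exp m :=
    Finset.sum_le_card_nsmul _ _ _ fun S hS => Real.exp_le_exp.2 (hf S hS)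
  have h2 : (F.card : ℝ) ≤ Real.exp n := by
    have h3 : (F.card : ℝ) ≤ 2 ^ n := by
      exact_mod_cast (Finset.card_le_univ F).trans_eq (by simp)
    refine h3.trans ?_
    rw [← Real.exp_one_pow]
    gcongr
    linarith [Real.add_one_le_exp (1 : ℝ)]
  rw [nsmul_eq_mul] at h1
  rw [Real.exp_add]
  exact h1.trans (by gcongr)

/-- The pre-imputations whose coordinates are bounded below as in a sublevel set of the
exponential penalty. -/
def boundedPreImputations {n : ℕ} (v : Game n) (b : ℝ) : Set (Payoff n) :=
  preImputations v ∩ {x | ∀ k, v {k} - x k ≤ b}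

lemma isCompact_boundedPreImputations {n : ℕ} (v : Game n) (b : ℝ) :
    IsCompact (boundedPreImputations v b) := by
  have hcl : IsClosed (boundedPreImputations v b) := by
    refine (isClosed_eq (continuous_coalitionSum _) continuous_const).inter ?_
    simp only [Set.ofPred_forall]
    exact isClosed_iInter fun k =>
      isClosed_le (continuous_const.sub (continuous_apply k)) continuous_const
  obtain ⟨c, hc⟩ : ∃ c, ∀ k : Fin n, b - v {k} ≤ c := by
    obtain ⟨c, hc⟩ := (Set.finite_range fun k : Fin n => b - v {k}).bddAbove
    exact ⟨c, fun k => hc ⟨k, rfl⟩⟩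
  refine Metric.isCompact_of_isClosed_isBounded hcl
    ((Metric.isBounded_Icc (fun _ => -max c 0 : Payoff n)
      (fun _ => v Finset.univ + n * max c 0)).subset ?_)
  rintro x ⟨hx, hxb⟩
  have hlow : ∀ k, -max c 0 ≤ x k := fun k => by
    linarith [hxb k, hc k, le_max_left c 0]
  exact ⟨hlow, le_of_coalitionSum_univ_le (le_max_right _ _) hlow (le_of_eq hx)⟩

lemma exists_mem_preImputations {n : ℕ} [NeZero n] (v : Game n) :
    ∃ x : Payoff n, x ∈ preImputations v :=
  ⟨Pi.single 0 (v Finset.univ), by simp [preImputations, coalitionSum]⟩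

/-- Outside the compact set a single singleton term already exceeds the whole penalty at `x₀`, since
`t * (π(x₀) + n) ≥ n + t * π(x₀)` for `t ≥ 1`. The set does not depend on `t`, which the later limit
needs. -/
lemma exists_isMinOn_expPenalty {n : ℕ} (v : Game n) {x₀ : Payoff n}
    (hx₀ : x₀ ∈ preImputations v) {t : ℝ} (ht : 1 ≤ t) :
    ∃ x ∈ boundedPreImputations v (indirectFn v x₀ + n),
      ∀ y ∈ preImputations v, expPenalty v t x ≤ expPenalty v t y := by
  have ht0 : 0 < t := one_pos.trans_le ht
  have hmem : x₀ ∈ boundedPreImputations v (indirectFn v x₀ + n) := by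
    refine ⟨hx₀, fun k => ?_⟩
    have := excess_le_indirectFn v x₀ {k}
    simp only [excess, coalitionSum_singleton] at this
    linarith [(Nat.cast_nonneg n : (0 : ℝ) ≤ n)]
  obtain ⟨x, hx, hmin⟩ := (isCompact_boundedPreImputations v _).exists_isMinOn ⟨x₀, hmem⟩
    (continuous_expPenalty v t).continuousOn
  refine ⟨x, hx, fun y hy => ?_⟩
  by_cases hyb : y ∈ boundedPreImputations v (indirectFn v x₀ + n)
  · exact hmin hyb
  obtain ⟨k, hk⟩ : ∃ k, indirectFn v x₀ + n < v {k} - y k := by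
    by_contra! h
    exact hyb ⟨hy, h⟩
  have h0 : expPenalty v t x₀ ≤ Real.exp (n + t * indirectFn v x₀) :=
    sum_exp_le _ fun S _ => mul_le_mul_of_nonneg_left (excess_le_indirectFn v x₀ S) ht0.le
  have h1 := exp_le_expPenalty v t y {k}
  simp only [excess, coalitionSum_singleton] at h1
  refine (hmin hmem).trans (h0.trans (le_trans (Real.exp_le_exp.2 ?_) h1))
  have h2 := mul_le_mul_of_nonneg_left hk.le ht0.le
  have h3 : (n : ℝ) ≤ t * n := le_mul_of_one_le_left (Nat.cast_nonneg n) ht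
  linarith

lemma transfer_mem_preImputations {n : ℕ} {v : Game n} {x : Payoff n}
    (hx : x ∈ preImputations v) {i j : Fin n} (h : i ≠ j) (d : ℝ) :
    transfer x i j d ∈ preImputations v := by
  have hx' : coalitionSum x Finset.univ = v Finset.univ := hx
  simp [preImputations, coalitionSum_transfer x h, hx']

/-- The first-order condition for a minimizer of the exponential penalty. -/
lemma sum_exp_eq_sum_exp {n : ℕ} {v : Game n} {t : ℝ} (ht : 0 < t) {x : Payoff n}
    (hx : x ∈ preImputations v)
    (hmin : ∀ y ∈ preImputations v, expPenalty v t x ≤ expPenalty v t y)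
    {i j : Fin n} (h : i ≠ j) :
    ∑ S with i ∈ S ∧ j ∉ S, Real.exp (t * excess v x S) =
      ∑ S with j ∈ S ∧ i ∉ S, Real.exp (t * excess v x S) := by
  -- The rate of change of the excess of `S` as `i` pays `j`; it vanishes when `S` contains both
  -- players or neither.
  let w : Finset (Fin n) → ℝ := fun S => (if i ∈ S then 1 else 0) - (if j ∈ S then 1 else 0)
  have hex : ∀ d S, excess v (transfer x i j d) S = excess v x S + d * w S := by
    intro d S
    simp only [excess, coalitionSum_transfer x h, w]
    split_ifs <;> ring
  have hd : HasDerivAt (fun d => expPenalty v t (transfer x i j d))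
      (∑ S : Finset (Fin n), Real.exp (t * excess v x S) * (t * w S)) 0 := by
    simp only [expPenalty, hex]
    refine HasDerivAt.fun_sum fun S _ => ?_
    have h1 : HasDerivAt (fun d : ℝ => t * (excess v x S + d * w S)) (t * (1 * w S)) 0 :=
      (((hasDerivAt_id (0 : ℝ)).mul_const (w S)).const_add _).const_mul t
    simpa using h1.exp
  have h0 : transfer x i j 0 = x := by
    ext k
    simp [transfer]
  have hloc : IsLocalMin (fun d => expPenalty v t (transfer x i j d)) 0 :=
    Filter.Eventually.of_forall fun d => by
      simp only [h0]
      exact hmin _ (transfer_mem_preImputations hx h d)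
  have hz := hloc.hasDerivAt_eq_zero hd
  have hsplit : ∑ S : Finset (Fin n), Real.exp (t * excess v x S) * (t * w S) =
      t * (∑ S with i ∈ S ∧ j ∉ S, Real.exp (t * excess v x S) -
        ∑ S with j ∈ S ∧ i ∉ S, Real.exp (t * excess v x S)) := by
    rw [Finset.sum_filter, Finset.sum_filter, ← Finset.sum_sub_distrib, Finset.mul_sum]
    refine Finset.sum_congr rfl fun S _ => ?_
    by_cases hi : i ∈ S <;> by_cases hj : j ∈ S <;> simp [w, hi, hj] <;> ring
  rw [hsplit] at hz
  exact sub_eq_zero.1 ((mul_eq_zero.1 hz).resolve_left ht.ne')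

/-- The largest term on one side is at most that side's sum, which equals the other side's sum and
so is at most `exp (n + t * s_ji)`. Take logarithms and divide by `t`. -/
lemma maxSurplus_le_add_div {n : ℕ} {v : Game n} {t : ℝ} (ht : 0 < t) {x : Payoff n}
    (hx : x ∈ preImputations v)
    (hmin : ∀ y ∈ preImputations v, expPenalty v t x ≤ expPenalty v t y)
    {i j : Fin n} (h : i ≠ j) : maxSurplus v x i j ≤ maxSurplus v x j i + n / t := by
  obtain ⟨S, hi, hj, hS⟩ := exists_excess_eq_maxSurplus v x h
  have h1 : Real.exp (t * maxSurplus v x i j) ≤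
      ∑ S with i ∈ S ∧ j ∉ S, Real.exp (t * excess v x S) := by
    rw [← hS]
    exact Finset.single_le_sum (f := fun S => Real.exp (t * excess v x S))
      (fun _ _ => (Real.exp_pos _).le) (by simp [hi, hj])
  have h2 : ∑ S with j ∈ S ∧ i ∉ S, Real.exp (t * excess v x S) ≤
      Real.exp (n + t * maxSurplus v x j i) :=
    sum_exp_le _ fun T hT => by
      have hT' := (Finset.mem_filter.1 hT).2
      exact mul_le_mul_of_nonneg_left (excess_le_maxSurplus v x hT'.1 hT'.2) ht.le
  rw [sum_exp_eq_sum_exp ht hx hmin h] at h1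
  have h3 := Real.exp_le_exp.1 (h1.trans h2)
  rw [← sub_le_iff_le_add', le_div_iff₀ ht]
  linarith

lemma preKernel_nonempty {n : ℕ} [NeZero n] (v : Game n) : (preKernel v).Nonempty := by
  obtain ⟨x₀, hx₀⟩ := exists_mem_preImputations v
  have ht : ∀ m : ℕ, (1 : ℝ) ≤ m + 1 := fun m => by
    linarith [(Nat.cast_nonneg m : (0 : ℝ) ≤ m)]
  -- Minimizers for `t = m + 1`.
  choose y hy hmin using fun m : ℕ => exists_isMinOn_expPenalty v hx₀ (ht m)
  obtain ⟨x, hx, φ, hφ, hlim⟩ := (isCompact_boundedPreImputations v _).tendsto_subseq hy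
  have hle : ∀ i j : Fin n, i ≠ j → maxSurplus v x i j ≤ maxSurplus v x j i := by
    intro i j hij
    have h1 := ((continuous_maxSurplus_right v hij).tendsto x).comp hlim
    have h2 := ((continuous_maxSurplus_right v hij.symm).tendsto x).comp hlim
    have h3 : Filter.Tendsto (fun m : ℕ => (n : ℝ) / (m + 1)) Filter.atTop (nhds 0) := by
      simpa [div_eq_mul_inv] using tendsto_one_div_add_atTop_nhds_zero_nat.const_mul (n : ℝ)
    have h4 := h2.add (h3.comp hφ.tendsto_atTop)
    rw [add_zero] at h4
    exact le_of_tendsto_of_tendsto' h1 h4 fun m =>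
      maxSurplus_le_add_div (one_pos.trans_le (ht _)) (hy _).1 (hmin _) hij
  -- The error `n / t` has vanished in the limit, and the inequality holds for both orders of each
  -- pair.
  exact ⟨x, hx.1, fun i j hij => le_antisymm (hle i j hij) (hle j i hij.symm)⟩

theorem proposition5p1 (n : ℕ) (hn : 2 ≤ n)
    (δ : Game n → Payoff n → ℝ) (hδ : ∀ v x, deltaOne v x ≤ δ v x) :
    (graph (fun v : Game n => preKernel v) = graph (fun v : Game n => zeroSet v (δ v))) ∧
    (graph (fun v : Game n => zeroSet v (δ v)) = (⋃ s : Profile n, restrictedGraph s)) ∧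
    (∀ v ∈ gameSpace n, (preKernel v).Nonempty) ∧
    IsClosed (graph (fun v : gameSpace n => preKernel (v : Game n))) ∧
    (∀ B : Set (Game n), B ⊆ gameSpace n → Bornology.IsBounded B →
      Bornology.IsBounded (⋃ v ∈ B, preKernel v)) := by
  have hzero : (fun v : Game n => zeroSet v (δ v)) = fun v => preKernel v :=
    funext fun v => zeroSet_eq_preKernel v (hδ v)
  have : NeZero n := ⟨by omega⟩
  rw [hzero]
  refine ⟨rfl, graph_preKernel_eq_iUnion n, fun v _ => preKernel_nonempty v, ?_,
    fun B _ hB => isBounded_iUnion_preKernel hB⟩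
  exact (isClosed_graph_preKernel n).preimage
    ((continuous_subtype_val.comp continuous_fst).prodMk continuous_snd)
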